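/- Let $f:\mathbb{R}\to\mathbb{R}$, $m\in\mathbb{R}$, $x_0\in\mathbb{R}\setminus\{0\}$, let $f$ be infinitely differentiable at $x_0$, and put $\gamma_k = \frac{f^{(k)}(x_0)}{k!}x_0^k$ for $k\ge 0$. Assume that $f(m)=\sum_{k=0}^\infty \gamma_k\left(\frac{m}{x_0}-1\right)^k$ and that (i) for some $c>0$, $|\gamma_k|\le c$ for all $k\ge 0$; (ii) $g^k=o(|\gamma_k|)$ as $k\to\infty$ for all $g\in(0,1)$; (iii) $\beta_0:=|m/x_0-1|<1$. Let $X_1,X_2,\dots$ be i.i.d. real random variables with mean $m$ and finite variance $\sigma^2$, and assume that $\beta<1$, where $\beta\ge 0$ and $\beta^2:=\frac{\sigma^2}{x_0^2}+\left(\frac{m}{x_0}-1\right)^2$. Let $p\in(0,1-\beta^2)$ and let $R$ be independent of $(X_i)_{i\ge1}$ with $\mathbb{P}(R=k)=(1-p)^kp$, $k=0,1,\dots$. For $r\ge 1$ and $0\le k\le r$ let $$U_{r,k}=\frac1r\sum_{j=1}^{r}\prod_{i=0}^{k-1}\left(\frac{X_{j+i}}{x_0}-1\right),$$ where the indices $j+i$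 are read cyclically modulo $r$ in $\{1,\dots,r\}$, let $U_{0,0}=1$, and let the cycling estimator be $$\hat f^{C}=\sum_{k=0}^{R}\frac{\gamma_k U_{R,k}}{\mathbb{P}(R\ge k)}.$$ Then $\hat f^{C}\in L^2$ and $$\mathbb{E}\left[\operatorname{var}(\hat f^{C}\mid R)\right]\le\frac{4c^2p\log(1/p)}{(1-p-\beta^2)^2}\left[\beta^2+2\,\frac{\beta_0(1-p)}{(1-\beta_0)^2}\right].$$ Moreover, with $f,x_0,m,\sigma,c$ fixed, as $\mathbb{E}[R]=(1-p)/p\to\infty$, both $\mathbb{E}[\operatorname{var}(\hat f^{C}\mid R)]$ and $\operatorname{var}(\hat f^{C})$ are $O\left(\log \mathbb{E}[R]/\mathbb{E}[R]\right)$. -/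

import Mathlib

open MeasureTheory ProbabilityTheory Filter

namespace SumEstimator

/-- The scaled Taylor coefficients `γ_k = f^{(k)}(x₀) / k! * x₀ ^ k`. -/
noncomputable def taylorCoeff (f : ℝ → ℝ) (x₀ : ℝ) (k : ℕ) : ℝ :=
  iteratedDeriv k f x₀ / (k.factorial : ℝ) * x₀ ^ k

/-- `β₀ = |m / x₀ - 1|`. -/
noncomputable def betaZero (x₀ m : ℝ) : ℝ := |m / x₀ - 1|

/-- `β`, the nonnegative number with `β² = σ² / x₀² + (m / x₀ - 1)²`. -/
noncomputable def beta (x₀ m σ : ℝ) : ℝ := √(σ ^ 2 / x₀ ^ 2 + (m / x₀ - 1) ^ 2)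

/-- The assumption on the function `f`, the argument `m` and the expansion point `x₀`: all
derivatives of `f` at `x₀` exist, the Taylor series at `x₀` represents `f` at `m`,
the coefficients `γ_k` are bounded by `c > 0` and decay slower than any geometric sequence, and
`β₀ < 1`. -/
structure TaylorAssumption (f : ℝ → ℝ) (x₀ m c : ℝ) : Prop where
  x₀_ne_zero : x₀ ≠ 0
  contDiffAt : ContDiffAt ℝ (⊤ : ℕ∞) f x₀
  hasSum : HasSum (fun k : ℕ => taylorCoeff f x₀ k * (m / x₀ - 1) ^ k) (f m)
  c_pos : 0 < c
  coeff_le : ∀ k, |taylorCoeff f x₀ k| ≤ c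
  pow_isLittleO : ∀ g : ℝ, 0 < g → g < 1 →
    (fun k : ℕ => g ^ k) =o[atTop] fun k : ℕ => |taylorCoeff f x₀ k|
  betaZero_lt_one : betaZero x₀ m < 1

/-- `X 0, X 1, …` are i.i.d. real random variables with mean `m` and (finite) variance `σ²`, and
`R` is a `Geometric(p)` variable on `{0, 1, 2, …}` independent of the whole sequence. -/
structure IsSample {Ω : Type*} [MeasurableSpace Ω] (μ : Measure Ω)
    (X : ℕ → Ω → ℝ) (R : Ω → ℕ) (m σ : ℝ) (p : unitInterval) : Prop where
  measurable_X : ∀ i, Measurable (X i)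
  iIndepFun_X : iIndepFun X μ
  identDistrib_X : ∀ i, IdentDistrib (X i) (X 0) μ μ
  memLp_X : MemLp (X 0) 2 μ
  mean_X : ∫ ω, X 0 ω ∂μ = m
  variance_X : Var[X 0; μ] = σ ^ 2
  measurable_R : Measurable R
  law_R : μ.map R = geometricMeasure p
  indepFun_R_X : IndepFun R (fun ω i => X i ω) μ

/-- The cycling estimate `U_{r,k}` of `(m / x₀ - 1) ^ k` (for `k ≤ r`) computed from
`x 0, …, x (r - 1)`: the average over the `r` circular shifts `j` of the products of `k` cyclically
consecutive factors. By convention `U_{0,0} = 1`. -/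
noncomputable def cyclingU (x₀ : ℝ) (x : ℕ → ℝ) (r k : ℕ) : ℝ :=
  if r = 0 then 1
  else (1 / (r : ℝ)) * ∑ j ∈ Finset.range r, ∏ i ∈ Finset.range k, (x ((j + i) % r) / x₀ - 1)

/-- The cycling sum estimator `∑_{k ≤ R} γ_k U_{R,k} / P(R ≥ k)`. -/
noncomputable def cyclingEstimator {Ω : Type*} [MeasurableSpace Ω] (μ : Measure Ω)
    (f : ℝ → ℝ) (x₀ : ℝ) (X : ℕ → Ω → ℝ) (R : Ω → ℕ) (ω : Ω) : ℝ :=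
  ∑ k ∈ Finset.range (R ω + 1),
    taylorCoeff f x₀ k * cyclingU x₀ (fun i => X i ω) (R ω) k / μ.real {ω' | k ≤ R ω'}

/-- `E[var(Y | R)]`, with the conditional variance given the σ-algebra generated by `R`. -/
noncomputable def expCondVar {Ω : Type*} [MeasurableSpace Ω] (μ : Measure Ω)
    (Y : Ω → ℝ) (R : Ω → ℕ) : ℝ :=
  ∫ ω, (Var[Y; μ | MeasurableSpace.comap R ⊤]) ω ∂μ

end SumEstimator

/-! Put `Y i = X i / x₀ - 1`, with mean `α = m / x₀ - 1` and second moment `B = β²`, and write `q =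
1 - p`, `b = |α|`. Since `P(R ≥ k) = q ^ k`, given `R = r` the estimator is a finite sum of the
`U_{r,k}` with weights `γ_k / q ^ k`, bounded by `c / q ^ k`.

Cycling gains a factor `1 / r`. For each of the `r` shifts of a window of length `k`, at most `k +
l` windows of length `l` meet it, and products over disjoint windows are uncorrelated. As `α² ≤ B`,
overlapping windows have covariance at most `b ^ |k - l| * B ^ min k l`, whatever the overlap
(`abs_covariance_cyclingU_le`). Averaging over `R` meets `∑_{r ≥ max k l} q ^ r / r`, which is at
most `q ^ (max k l - 1) * log (1 / p)`. Against `q ^ (k + l)` this leaves the series `∑ (k + l) b ^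
|k - l| (B / q) ^ min k l`, convergent because `B < q` (`sum_geometric_mul_varBound_le`).

The total variance adds the variance of the conditional mean, at most its mean square distance to `f
m`. That distance is `O(p) + O(b ^ r)`, so its geometric mean square is `O(p)`. Finally `p` and `p *
log (1 / p)` are `O(log M / M)` for `M = E[R] = (1 - p) / p`. -/

namespace SumEstimator

/-! ### Covariances of products of independent variables. -/

section Products

variable {Ω : Type*} [MeasurableSpace Ω] {μ : Measure Ω}

/-- The product of finitely many independent integrable variables is integrable, and its
expectation is the product of the expectations. -/
theorem integrable_and_integral_prod_of_iIndepFun [IsProbabilityMeasure μ] {Z : ℕ → Ω → ℝ}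
    (hZ : iIndepFun Z μ) (hm : ∀ i, Measurable (Z i)) (hi : ∀ i, Integrable (Z i) μ)
    (s : Finset ℕ) :
    Integrable (∏ i ∈ s, Z i) μ ∧ ∫ ω, (∏ i ∈ s, Z i) ω ∂μ = ∏ i ∈ s, ∫ ω, Z i ω ∂μ := by
  induction s using Finset.induction_on with
  | empty => exact ⟨by simpa using! integrable_const (1 : ℝ), by simp⟩
  | insert a s ha ih =>
    have hind := (hZ.indepFun_finsetProd_of_notMem hm ha).symm
    rw [Finset.prod_insert ha, Finset.prod_insert ha]
    refine ⟨hind.integrable_mul (hi a) ih.1, ?_⟩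
    rw [← ih.2]
    exact hind.integral_mul_eq_mul_integral (hi a).1 ih.1.1

variable {Y : ℕ → Ω → ℝ} {α B : ℝ}

/-- Independent variables `Y i` in `L²` with common mean `α` and common second moment `B`. -/
structure IndepMoments (μ : Measure Ω) (Y : ℕ → Ω → ℝ) (α B : ℝ) : Prop where
  measurable : ∀ i, Measurable (Y i)
  indep : iIndepFun Y μ
  memLp : ∀ i, MemLp (Y i) 2 μ
  mean : ∀ i, ∫ ω, Y i ω ∂μ = α
  second : ∀ i, ∫ ω, Y i ω ^ 2 ∂μ = B

namespace IndepMoments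

variable [IsProbabilityMeasure μ] (h : IndepMoments μ Y α B)

include h

theorem memLp_prod (s : Finset ℕ) : MemLp (fun ω => ∏ i ∈ s, Y i ω) 2 μ := by
  rw [memLp_two_iff_integrable_sq
    (Finset.measurable_fun_prod s fun i _ => h.measurable i).aestronglyMeasurable]
  have := (integrable_and_integral_prod_of_iIndepFun
    (h.indep.comp (fun _ x => x ^ 2) fun _ => by fun_prop)
    (fun i => (h.measurable i).pow_const 2) (fun i => (h.memLp i).integrable_sq) s).1
  refine this.congr (Eventually.of_forall fun ω => ?_)
  simp [Finset.prod_apply, Finset.prod_pow]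

theorem integral_prod (s : Finset ℕ) : ∫ ω, ∏ i ∈ s, Y i ω ∂μ = α ^ s.card := by
  have := (integrable_and_integral_prod_of_iIndepFun h.indep h.measurable
    (fun i => (h.memLp i).integrable one_le_two) s).2
  simpa [Finset.prod_apply, h.mean] using this

theorem integral_prod_mul_prod (s t : Finset ℕ) :
    ∫ ω, (∏ i ∈ s, Y i ω) * ∏ i ∈ t, Y i ω ∂μ
      = B ^ (s ∩ t).card * α ^ ((s ∪ t) \ (s ∩ t)).card := by
  -- The two products merge into one product over `s ∪ t` of functions of single variables: `e i x`
  -- is `x²` on the intersection and `x` on the symmetric difference.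
  let e : ℕ → ℝ → ℝ := fun i x => (if i ∈ s then x else 1) * (if i ∈ t then x else 1)
  have he : ∀ i, Measurable (e i) := by
    intro i
    by_cases h1 : i ∈ s <;> by_cases h2 : i ∈ t <;> simp only [e, h1, h2, if_true, if_false] <;>
      fun_prop
  have hint : ∀ i, Integrable (fun ω => e i (Y i ω)) μ := by
    intro i
    have h1 := (h.memLp i).integrable one_le_two
    have h2 := (h.memLp i).integrable_sq
    by_cases hs : i ∈ s <;> by_cases ht : i ∈ t <;> simp [e, hs, ht, ← sq, h1, h2]
  have key := (integrable_and_integral_prod_of_iIndepFun (h.indep.comp e he)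
    (fun i => (he i).comp (h.measurable i)) hint (s ∪ t)).2
  have hmom : ∀ i ∈ s ∪ t, ∫ ω, (e i ∘ Y i) ω ∂μ = if i ∈ s ∩ t then B else α := by
    intro i hi
    have := h.mean i
    have := h.second i
    by_cases hs : i ∈ s <;> by_cases ht : i ∈ t <;> simp_all [e, ← sq]
  rw [Finset.prod_congr rfl hmom, Finset.prod_ite] at key
  simp only [Finset.prod_const] at key
  have hf1 : (s ∪ t).filter (· ∈ s ∩ t) = s ∩ t := by ext; simp; tauto
  have hf2 : (s ∪ t).filter (· ∉ s ∩ t) = (s ∪ t) \ (s ∩ t) := by ext; simp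
  rw [hf1, hf2] at key
  rw [← key]
  refine integral_congr_ae (Eventually.of_forall fun ω => ?_)
  simp only [Finset.prod_apply, Function.comp, e, Finset.prod_mul_distrib]
  congr 1
  · rw [Finset.prod_ite_mem, Finset.inter_eq_right.2 Finset.subset_union_left]
  · rw [Finset.prod_ite_mem, Finset.inter_eq_right.2 Finset.subset_union_right]

theorem sq_mean_le : α ^ 2 ≤ B := by
  have h1 := variance_nonneg (Y 0) μ
  rw [variance_eq_sub (h.memLp 0)] at h1
  have h2 := h.mean 0
  have h3 := h.second 0
  simp only [Pi.pow_apply] at h1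
  rw [h2, h3] at h1
  linarith

theorem covariance_prod (s t : Finset ℕ) :
    cov[fun ω => ∏ i ∈ s, Y i ω, fun ω => ∏ i ∈ t, Y i ω; μ]
      = (B ^ (s ∩ t).card - (α ^ 2) ^ (s ∩ t).card) * α ^ ((s ∪ t) \ (s ∩ t)).card := by
  rw [covariance_eq_sub (h.memLp_prod s) (h.memLp_prod t)]
  simp only [Pi.mul_apply]
  rw [h.integral_prod_mul_prod, h.integral_prod, h.integral_prod, sub_mul, ← pow_add, ← pow_mul,
    ← pow_add]
  congr 2
  have h1 := Finset.card_union_add_card_inter s t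
  have h2 := Finset.card_sdiff_add_card_eq_card
    (show s ∩ t ⊆ s ∪ t from Finset.inter_subset_left.trans Finset.subset_union_left)
  omega

theorem covariance_prod_of_disjoint {s t : Finset ℕ} (hst : Disjoint s t) :
    cov[fun ω => ∏ i ∈ s, Y i ω, fun ω => ∏ i ∈ t, Y i ω; μ] = 0 := by
  rw [h.covariance_prod, Finset.disjoint_iff_inter_eq_empty.1 hst]
  simp

/-- The exponent of `α` is the difference of the sizes plus twice the part of the smaller set
outside the overlap. Trading each surplus `α²` for `B` makes the bound independent of the overlap.
The sum of two truncated subtractions encodes the absolute difference. -/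
theorem abs_covariance_prod_le (s t : Finset ℕ) :
    |cov[fun ω => ∏ i ∈ s, Y i ω, fun ω => ∏ i ∈ t, Y i ω; μ]|
      ≤ |α| ^ (s.card - t.card + (t.card - s.card)) * B ^ min s.card t.card := by
  have hB := h.sq_mean_le
  have hB0 : 0 ≤ B := (sq_nonneg α).trans hB
  rw [h.covariance_prod, abs_mul, abs_pow]
  set o := (s ∩ t).card
  have ho1 : o ≤ min s.card t.card :=
    le_min (Finset.card_le_card Finset.inter_subset_left)
      (Finset.card_le_card Finset.inter_subset_right)
  have hcard : ((s ∪ t) \ (s ∩ t)).card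
      = (s.card - t.card + (t.card - s.card)) + 2 * (min s.card t.card - o) := by
    have h1 := Finset.card_union_add_card_inter s t
    have h2 := Finset.card_sdiff_add_card_eq_card
      (show s ∩ t ⊆ s ∪ t from Finset.inter_subset_left.trans Finset.subset_union_left)
    omega
  have h1 : |B ^ o - (α ^ 2) ^ o| ≤ B ^ o := by
    rw [abs_of_nonneg (sub_nonneg.2 (pow_le_pow_left₀ (sq_nonneg α) hB o))]
    have : 0 ≤ (α ^ 2) ^ o := by positivity
    linarith
  have h2 : |α| ^ ((s ∪ t) \ (s ∩ t)).card
      ≤ |α| ^ (s.card - t.card + (t.card - s.card)) * B ^ (min s.card t.card - o) := by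
    rw [hcard, pow_add, pow_mul, sq_abs]
    gcongr
  calc _ ≤ B ^ o * (|α| ^ (s.card - t.card + (t.card - s.card)) * B ^ (min s.card t.card - o)) :=
        mul_le_mul h1 h2 (by positivity) (by positivity)
    _ = _ := by
        rw [mul_left_comm, ← pow_add]
        congr 2
        omega

end IndepMoments

end Products

/-! ### Cyclic windows and how often they meet. -/

section Windows

/-- The window of `k` cyclically consecutive indices modulo `r` that starts at `j`. -/
def window (r j k : ℕ) : Finset ℕ := (Finset.range k).image fun i => (j + i) % r

theorem injOn_add_mod {r k : ℕ} (hk : k ≤ r) (j : ℕ) :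
    Set.InjOn (fun i => (j + i) % r) (Finset.range k : Finset ℕ) := by
  intro a ha b hb hab
  simp only [Finset.coe_range, Set.mem_Iio] at ha hb
  have h : j + a ≡ j + b [MOD r] := hab
  exact Nat.ModEq.eq_of_lt_of_lt (Nat.ModEq.add_left_cancel' j h) (by omega) (by omega)

theorem card_window {r k : ℕ} (hk : k ≤ r) (j : ℕ) : (window r j k).card = k := by
  rw [window, Finset.card_image_of_injOn (injOn_add_mod hk j), Finset.card_range]

theorem prod_window {r k : ℕ} (hk : k ≤ r) (j : ℕ) (y : ℕ → ℝ) :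
    ∏ i ∈ Finset.range k, y ((j + i) % r) = ∏ i ∈ window r j k, y i := by
  rw [window, Finset.prod_image (injOn_add_mod hk j)]

/-- A common point forces `j' ≡ j + i - i'` with `i < k` and `i' < l`, leaving `k + l` candidates
that start at `j - l`. The term `r - l` stands for `-l` modulo `r`, and the offset is `i + (l -
i')`. -/
theorem card_not_disjoint_window_le {r k l : ℕ} (hl : l ≤ r) (j : ℕ) :
    ((Finset.range r).filter fun j' => ¬ Disjoint (window r j k) (window r j' l)).card
      ≤ k + l := by
  calc _ ≤ ((Finset.range (k + l)).image fun e => (j + (r - l) + e) % r).card := by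
        refine Finset.card_le_card fun j' hj' => ?_
        rw [Finset.mem_filter] at hj'
        simp only [Finset.mem_range, Finset.not_disjoint_iff, window, Finset.mem_image] at hj' ⊢
        obtain ⟨hj'r, _, ⟨i, hi, rfl⟩, i', hi', hii⟩ := hj'
        refine ⟨i + (l - i'), by omega, ?_⟩
        have h1 : j' + i' ≡ j + i [MOD r] := hii
        have h2 : j + (r - l) + (i + (l - i')) + i' ≡ j' + i' [MOD r] := by
          refine Nat.ModEq.trans ?_ h1.symm
          rw [show j + (r - l) + (i + (l - i')) + i' = j + i + r by omega]
          simp [Nat.ModEq]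
        have h3 := Nat.ModEq.add_right_cancel' i' h2
        rw [← Nat.mod_eq_of_lt hj'r]
        exact h3
    _ ≤ k + l := Finset.card_image_le.trans (Finset.card_range _).le

end Windows

/-! ### The estimator of deterministic length. -/

section FixedLength

variable {Ω : Type*} [MeasurableSpace Ω] {μ : Measure Ω} [IsProbabilityMeasure μ]
  {X : ℕ → Ω → ℝ} {x₀ α B : ℝ}

theorem cyclingU_eq_sum_window {r k : ℕ} (hr : r ≠ 0) (hk : k ≤ r) (x : ℕ → ℝ) :
    cyclingU x₀ x r k
      = 1 / (r : ℝ) * ∑ j ∈ Finset.range r, ∏ i ∈ window r j k, (x i / x₀ - 1) := by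
  rw [cyclingU, if_neg hr]
  congr 1
  exact Finset.sum_congr rfl fun j _ => prod_window hk j fun i => x i / x₀ - 1

theorem memLp_cyclingU (h : IndepMoments μ (fun i ω => X i ω / x₀ - 1) α B) {r k : ℕ}
    (hk : k ≤ r) : MemLp (fun ω => cyclingU x₀ (fun i => X i ω) r k) 2 μ := by
  rcases eq_or_ne r 0 with rfl | hr
  · simpa [cyclingU] using memLp_const (1 : ℝ)
  · simp only [cyclingU_eq_sum_window hr hk]
    exact (memLp_finsetSum _ fun j _ => h.memLp_prod _).const_mul _

theorem integral_cyclingU (h : IndepMoments μ (fun i ω => X i ω / x₀ - 1) α B) {r k : ℕ}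
    (hk : k ≤ r) : ∫ ω, cyclingU x₀ (fun i => X i ω) r k ∂μ = α ^ k := by
  rcases eq_or_ne r 0 with rfl | hr
  · simp [cyclingU, Nat.le_zero.1 hk]
  · simp only [cyclingU_eq_sum_window hr hk]
    rw [integral_const_mul,
      integral_finsetSum _ fun j _ => (h.memLp_prod _).integrable one_le_two]
    simp only [h.integral_prod, card_window hk]
    have : (r : ℝ) ≠ 0 := by exact_mod_cast hr
    simp [this]

/-- Of the `r²` pairs of shifts at most `r * (k + l)` contribute, which yields the factor `(k + l) /
r`. At `r = 0` both sides vanish: the variables are constant and division by zero gives zero. -/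
theorem abs_covariance_cyclingU_le (h : IndepMoments μ (fun i ω => X i ω / x₀ - 1) α B)
    {r k l : ℕ} (hk : k ≤ r) (hl : l ≤ r) :
    |cov[fun ω => cyclingU x₀ (fun i => X i ω) r k,
        fun ω => cyclingU x₀ (fun i => X i ω) r l; μ]|
      ≤ (k + l) / r * (|α| ^ (k - l + (l - k)) * B ^ min k l) := by
  rcases eq_or_ne r 0 with rfl | hr
  · simp [cyclingU]
  have hr' : (0 : ℝ) < r := by exact_mod_cast Nat.pos_of_ne_zero hr
  have hB0 : 0 ≤ B := (sq_nonneg α).trans h.sq_mean_le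
  simp only [cyclingU_eq_sum_window hr hk, cyclingU_eq_sum_window hr hl]
  rw [covariance_const_mul_left, covariance_const_mul_right,
    covariance_fun_sum_fun_sum' (fun j _ => h.memLp_prod _) (fun j _ => h.memLp_prod _)]
  set φ := |α| ^ (k - l + (l - k)) * B ^ min k l with hφ
  have hφ0 : 0 ≤ φ := by positivity
  have hrow : ∀ j ∈ Finset.range r, |∑ j' ∈ Finset.range r,
      cov[fun ω => ∏ i ∈ window r j k, (X i ω / x₀ - 1),
        fun ω => ∏ i ∈ window r j' l, (X i ω / x₀ - 1); μ]| ≤ (k + l) * φ := by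
    intro j _
    calc _ ≤ ∑ j' ∈ Finset.range r,
          if ¬ Disjoint (window r j k) (window r j' l) then φ else 0 := by
          refine (Finset.abs_sum_le_sum_abs _ _).trans (Finset.sum_le_sum fun j' _ => ?_)
          split_ifs with hd
          · rw [h.covariance_prod_of_disjoint hd, abs_zero]
          · have := h.abs_covariance_prod_le (window r j k) (window r j' l)
            rwa [card_window hk, card_window hl] at this
      _ = ((Finset.range r).filter
            fun j' => ¬ Disjoint (window r j k) (window r j' l)).card * φ := by
          rw [← Finset.sum_filter, Finset.sum_const, nsmul_eq_mul]
      _ ≤ (k + l) * φ := by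
          gcongr
          exact_mod_cast card_not_disjoint_window_le hl j
  have hsum := (Finset.abs_sum_le_sum_abs _ _).trans (Finset.sum_le_sum hrow)
  rw [Finset.sum_const, Finset.card_range, nsmul_eq_mul] at hsum
  rw [abs_mul, abs_mul, abs_of_pos (one_div_pos.2 hr')]
  calc _ ≤ 1 / (r : ℝ) * (1 / (r : ℝ) * (r * ((k + l) * φ))) := by gcongr
    _ = _ := by field_simp

/-- The sum estimator of fixed length `r` with weights `a`. -/
noncomputable def fixedSum (x₀ : ℝ) (a : ℕ → ℝ) (r : ℕ) (x : ℕ → ℝ) : ℝ :=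
  ∑ k ∈ Finset.range (r + 1), a k * cyclingU x₀ x r k

theorem measurable_fixedSum (a : ℕ → ℝ) (r : ℕ) : Measurable (fixedSum x₀ a r) := by
  refine Finset.measurable_fun_sum _ fun k _ => Measurable.const_mul ?_ _
  rcases eq_or_ne r 0 with rfl | hr
  · simp [cyclingU]
  · simp only [cyclingU, if_neg hr]
    fun_prop

variable (h : IndepMoments μ (fun i ω => X i ω / x₀ - 1) α B) (a : ℕ → ℝ) (r : ℕ)

include h

theorem memLp_fixedSum : MemLp (fun ω => fixedSum x₀ a r fun i => X i ω) 2 μ :=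
  memLp_finsetSum _ fun _ hk =>
    (memLp_cyclingU h (Finset.mem_range_succ_iff.1 hk)).const_mul _

theorem integral_fixedSum :
    ∫ ω, fixedSum x₀ a r (fun i => X i ω) ∂μ = ∑ k ∈ Finset.range (r + 1), a k * α ^ k := by
  unfold fixedSum
  rw [integral_finsetSum _ fun k hk => ((memLp_cyclingU h
    (Finset.mem_range_succ_iff.1 hk)).integrable one_le_two).const_mul _]
  refine Finset.sum_congr rfl fun k hk => ?_
  rw [integral_const_mul, integral_cyclingU h (Finset.mem_range_succ_iff.1 hk)]

theorem variance_fixedSum_le {w : ℕ → ℝ} (hw : ∀ k, |a k| ≤ w k) :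
    Var[fun ω => fixedSum x₀ a r (fun i => X i ω); μ]
      ≤ ∑ k ∈ Finset.range (r + 1), ∑ l ∈ Finset.range (r + 1),
          w k * w l * ((k + l) / r * (|α| ^ (k - l + (l - k)) * B ^ min k l)) := by
  unfold fixedSum
  rw [variance_fun_sum' fun k hk => (memLp_cyclingU h
    (Finset.mem_range_succ_iff.1 hk)).const_mul _]
  refine Finset.sum_le_sum fun k hk => Finset.sum_le_sum fun l hl => ?_
  rw [covariance_const_mul_left, covariance_const_mul_right, ← mul_assoc]
  refine (le_abs_self _).trans ?_
  rw [abs_mul, abs_mul]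
  have hcov := abs_covariance_cyclingU_le h (Finset.mem_range_succ_iff.1 hk)
    (Finset.mem_range_succ_iff.1 hl)
  have hw0 : ∀ k, 0 ≤ w k := fun k => (abs_nonneg _).trans (hw k)
  have hk' := hw0 k
  have hl' := hw0 l
  exact mul_le_mul (mul_le_mul (hw k) (hw l) (abs_nonneg _) hk') hcov (abs_nonneg _)
    (by positivity)

end FixedLength

/-! ### Randomizing the length by an independent `R`: Fubini and total variance. -/

section Mixture

variable {Ω E : Type*} [MeasurableSpace Ω] [MeasurableSpace E] {μ : Measure Ω}
  [IsProbabilityMeasure μ] {R : Ω → ℕ} {X : Ω → E} {F : ℕ → E → ℝ}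

theorem integrable_comp_indep (hR : Measurable R) (hX : Measurable X) (hind : IndepFun R X μ)
    {G : ℕ → E → ℝ} (hG : ∀ r, Measurable (G r)) (hG0 : ∀ r x, 0 ≤ G r x)
    (hGi : ∀ r, Integrable (fun ω => G r (X ω)) μ)
    (hsum : Integrable (fun r => ∫ ω, G r (X ω) ∂μ) (μ.map R)) :
    Integrable (fun ω => G (R ω) (X ω)) μ := by
  have hGm : Measurable fun z : ℕ × E => G z.1 z.2 := measurable_from_prod_countable_right hG
  have hmap := (indepFun_iff_map_prod_eq_prod_map_map hR.aemeasurable hX.aemeasurable).1 hind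
  have : IsProbabilityMeasure (μ.map X) := Measure.isProbabilityMeasure_map hX.aemeasurable
  have key : Integrable (fun z : ℕ × E => G z.1 z.2) (μ.map fun ω => (R ω, X ω)) := by
    rw [hmap, integrable_prod_iff hGm.aestronglyMeasurable]
    refine ⟨Eventually.of_forall fun r => ?_, hsum.congr (Eventually.of_forall fun r => ?_)⟩
    · exact (integrable_map_measure (hG r).aestronglyMeasurable hX.aemeasurable).2 (hGi r)
    · simp only [Real.norm_of_nonneg (hG0 r _)]
      exact (integral_map hX.aemeasurable (hG r).aestronglyMeasurable).symm
  exact (integrable_map_measure hGm.aestronglyMeasurable (hR.prodMk hX).aemeasurable).1 key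

/-- Fubini for the product law of `(R, X)`. A general `s` is needed because the events of `σ(R)` are
the preimages `R ⁻¹' s`, on which the conditional expectation is tested; `Set.univ` gives the plain
expectation. -/
theorem setIntegral_comp_indep (hR : Measurable R) (hX : Measurable X) (hind : IndepFun R X μ)
    {G : ℕ → E → ℝ} (hG : ∀ r, Measurable (G r))
    (hGi : Integrable (fun ω => G (R ω) (X ω)) μ) (s : Set ℕ) :
    ∫ ω in R ⁻¹' s, G (R ω) (X ω) ∂μ = ∫ r in s, ∫ ω, G r (X ω) ∂μ ∂(μ.map R) := by
  have hGm : Measurable fun z : ℕ × E => G z.1 z.2 := measurable_from_prod_countable_right hG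
  have hmap := (indepFun_iff_map_prod_eq_prod_map_map hR.aemeasurable hX.aemeasurable).1 hind
  have : IsProbabilityMeasure (μ.map X) := Measure.isProbabilityMeasure_map hX.aemeasurable
  have key : Integrable (fun z : ℕ × E => G z.1 z.2) (μ.map fun ω => (R ω, X ω)) :=
    (integrable_map_measure hGm.aestronglyMeasurable (hR.prodMk hX).aemeasurable).2 hGi
  have hs : MeasurableSet (s ×ˢ (Set.univ : Set E)) := s.to_countable.measurableSet.prod .univ
  have h1 : R ⁻¹' s = (fun ω => (R ω, X ω)) ⁻¹' (s ×ˢ (Set.univ : Set E)) := by ext; simp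
  have h2 := setIntegral_map (μ := μ) hs
    (hGm.aestronglyMeasurable (μ := μ.map fun ω => (R ω, X ω))) (hR.prodMk hX).aemeasurable
  rw [h1, ← h2, hmap, setIntegral_prod _ (by rw [← hmap]; exact key.integrableOn)]
  simp only [Measure.restrict_univ]
  exact integral_congr_ae (Eventually.of_forall fun r =>
    integral_map hX.aemeasurable (hG r).aestronglyMeasurable)

variable (hR : Measurable R) (hX : Measurable X) (hind : IndepFun R X μ)
  (hF : ∀ r, Measurable (F r)) (hL : ∀ r, MemLp (fun ω => F r (X ω)) 2 μ)
  (hvar : Integrable (fun r => Var[fun ω => F r (X ω); μ]) (μ.map R))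
  (hmean : Integrable (fun r => (∫ ω, F r (X ω) ∂μ) ^ 2) (μ.map R))

include hR hX hind hF hL hvar hmean

theorem memLp_comp_indep : MemLp (fun ω => F (R ω) (X ω)) 2 μ := by
  have hFm : Measurable fun z : ℕ × E => F z.1 z.2 := measurable_from_prod_countable_right hF
  have hm : Measurable fun ω => F (R ω) (X ω) := hFm.comp (hR.prodMk hX)
  rw [memLp_two_iff_integrable_sq hm.aestronglyMeasurable]
  refine integrable_comp_indep (G := fun r x => F r x ^ 2) hR hX hind
    (fun r => (hF r).pow_const 2) (fun _ _ => sq_nonneg _) (fun r => (hL r).integrable_sq) ?_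
  refine (hvar.add hmean).congr (Eventually.of_forall fun r => ?_)
  simp only [Pi.add_apply, variance_eq_sub (hL r), Pi.pow_apply]
  ring

theorem condExp_comp_indep :
    (fun ω => ∫ ω', F (R ω) (X ω') ∂μ)
      =ᵐ[μ] μ[fun ω => F (R ω) (X ω) | MeasurableSpace.comap R ⊤] := by
  have hY := (memLp_comp_indep hR hX hind hF hL hvar hmean).integrable one_le_two
  have hle : MeasurableSpace.comap R ⊤ ≤ ‹MeasurableSpace Ω› := hR.comap_le
  have hg : Integrable (fun r => ∫ ω, F r (X ω) ∂μ) (μ.map R) := by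
    have : IsProbabilityMeasure (μ.map R) := Measure.isProbabilityMeasure_map hR.aemeasurable
    exact ((memLp_two_iff_integrable_sq
      (measurable_of_countable _).aestronglyMeasurable).2 hmean).integrable one_le_two
  have hgR : Integrable (fun ω => ∫ ω', F (R ω) (X ω') ∂μ) μ :=
    (integrable_map_measure hg.1 hR.aemeasurable).1 hg
  refine ae_eq_condExp_of_forall_setIntegral_eq hle hY (fun s _ _ => hgR.integrableOn) ?_ ?_
  · rintro _ ⟨s, _, rfl⟩ _
    rw [setIntegral_comp_indep hR hX hind hF hY s,
      setIntegral_map s.to_countable.measurableSet hg.1 hR.aemeasurable]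
  · exact ((measurable_of_countable (fun r => ∫ ω', F r (X ω') ∂μ)).comp
      (comap_measurable R)).stronglyMeasurable.aestronglyMeasurable

theorem expCondVar_comp_indep :
    expCondVar μ (fun ω => F (R ω) (X ω)) R
      = ∫ r, Var[fun ω => F r (X ω); μ] ∂(μ.map R) := by
  have hle : MeasurableSpace.comap R ⊤ ≤ ‹MeasurableSpace Ω› := hR.comap_le
  have hce := condExp_comp_indep hR hX hind hF hL hvar hmean
  have hvar' : ∀ r, Var[fun ω => F r (X ω); μ]
      = ∫ ω, (F r (X ω) - ∫ ω', F r (X ω') ∂μ) ^ 2 ∂μ :=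
    fun r => variance_eq_integral ((hF r).comp hX).aemeasurable
  rw [expCondVar, condVar, integral_condExp hle]
  have hG : ∀ r, Measurable fun x => (F r x - ∫ ω', F r (X ω') ∂μ) ^ 2 :=
    fun r => ((hF r).sub_const _).pow_const 2
  have hint := integrable_comp_indep (G := fun r x => (F r x - ∫ ω', F r (X ω') ∂μ) ^ 2)
    hR hX hind hG (fun _ _ => sq_nonneg _)
    (fun r => ((hL r).sub (memLp_const _)).integrable_sq)
    (hvar.congr (Eventually.of_forall hvar'))
  have h1 := setIntegral_comp_indep hR hX hind hG hint Set.univ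
  simp only [Set.preimage_univ, Measure.restrict_univ] at h1
  simp only [hvar', ← h1]
  refine integral_congr_ae ?_
  filter_upwards [hce] with ω hω
  simp [← hω]

/-- Law of total variance, with the variance of the conditional mean bounded by its mean square
deviation from an arbitrary constant. Later `b = f m`, which avoids computing the mean of the
estimator. -/
theorem variance_comp_indep_le (b : ℝ)
    (hb : Integrable (fun r => (∫ ω, F r (X ω) ∂μ - b) ^ 2) (μ.map R)) :
    Var[fun ω => F (R ω) (X ω); μ] ≤ expCondVar μ (fun ω => F (R ω) (X ω)) R
      + ∫ r, (∫ ω, F r (X ω) ∂μ - b) ^ 2 ∂(μ.map R) := by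
  have hle : MeasurableSpace.comap R ⊤ ≤ ‹MeasurableSpace Ω› := hR.comap_le
  rw [← integral_condVar_add_variance_condExp hle
    (memLp_comp_indep hR hX hind hF hL hvar hmean)]
  refine add_le_add le_rfl ?_
  have hm : Measurable fun ω => ∫ ω', F (R ω) (X ω') ∂μ :=
    (measurable_of_countable (fun r => ∫ ω', F r (X ω') ∂μ)).comp hR
  rw [← variance_congr (condExp_comp_indep hR hX hind hF hL hvar hmean),
    ← variance_sub_const hm.aestronglyMeasurable b,
    integral_map hR.aemeasurable hb.1]
  exact variance_le_expectation_sq (hm.sub_const b).aestronglyMeasurable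

end Mixture

/-! ### Deterministic estimates of series. -/

section Series

theorem sum_sum_range_of_symm {ψ : ℕ → ℕ → ℝ} (hψ : ∀ k l, ψ k l = ψ l k) (N : ℕ) :
    ∑ k ∈ Finset.range N, ∑ l ∈ Finset.range N, ψ k l
      = ∑ k ∈ Finset.range N, (ψ k k + 2 * ∑ l ∈ Finset.Ico (k + 1) N, ψ k l) := by
  induction N with
  | zero => simp
  | succ N ih =>
    have h1 : ∀ k ∈ Finset.range N, ψ k k + 2 * ∑ l ∈ Finset.Ico (k + 1) (N + 1), ψ k l
        = (ψ k k + 2 * ∑ l ∈ Finset.Ico (k + 1) N, ψ k l) + 2 * ψ k N := by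
      intro k hk
      rw [Finset.sum_Ico_succ_top (by simpa using hk)]
      ring
    rw [Finset.sum_range_succ (fun k => ψ k k + 2 * ∑ l ∈ Finset.Ico (k + 1) (N + 1), ψ k l),
      Finset.sum_congr rfl h1, Finset.sum_add_distrib, ← ih]
    simp only [Finset.sum_range_succ, Finset.sum_add_distrib, ← Finset.mul_sum, Finset.Ico_self,
      Finset.sum_empty]
    rw [Finset.sum_congr rfl fun l _ => hψ N l]
    ring

theorem hasSum_coe_mul_pow {b : ℝ} (hb0 : 0 ≤ b) (hb1 : b < 1) :
    HasSum (fun n : ℕ => (n : ℝ) * b ^ n) (b / (1 - b) ^ 2) :=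
  hasSum_coe_mul_geometric_of_norm_lt_one (by rwa [Real.norm_of_nonneg hb0])

/-- The double series `∑ (k + l) b ^ |k - l| x ^ min k l`, bounded along its diagonals. -/
theorem sum_sum_add_mul_pow_le {b x : ℝ} (hb0 : 0 ≤ b) (hb1 : b < 1) (hx0 : 0 ≤ x) (hx1 : x < 1)
    (N : ℕ) :
    ∑ k ∈ Finset.range N, ∑ l ∈ Finset.range N,
        ((k : ℝ) + l) * (b ^ (k - l + (l - k)) * x ^ min k l)
      ≤ (2 + 4 * (b / (1 - b))) * (x / (1 - x) ^ 2) + 2 * (b / (1 - b) ^ 2) * (1 - x)⁻¹ := by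
  rw [sum_sum_range_of_symm fun k l => by rw [add_comm (k : ℝ), add_comm (k - l), min_comm]]
  -- With `l = k + d + 1`, the factor `k + l` is `2k + (d + 1)`, so the row beyond the diagonal sums
  -- to at most `(2k b/(1-b) + b/(1-b)²) x ^ k`. It counts twice, and the diagonal adds `2k x ^ k`.
  have hrow : ∀ k ∈ Finset.range N,
      ((k : ℝ) + k) * (b ^ (k - k + (k - k)) * x ^ min k k)
          + 2 * ∑ l ∈ Finset.Ico (k + 1) N, ((k : ℝ) + l) * (b ^ (k - l + (l - k)) * x ^ min k l)
        ≤ (2 + 4 * (b / (1 - b))) * ((k : ℝ) * x ^ k) + 2 * (b / (1 - b) ^ 2) * x ^ k := by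
    intro k _
    have hd1 : HasSum (fun d : ℕ => ((d : ℝ) + 1) * b ^ (d + 1)) (b / (1 - b) ^ 2) := by
      have := (hasSum_nat_add_iff' 1).2 (hasSum_coe_mul_pow hb0 hb1)
      simpa using this
    have hd2 : HasSum (fun d : ℕ => b ^ (d + 1)) (b / (1 - b)) := by
      simpa [pow_succ', div_eq_mul_inv] using (hasSum_geometric_of_lt_one hb0 hb1).mul_left b
    have hle : ∑ l ∈ Finset.Ico (k + 1) N, ((k : ℝ) + l) * (b ^ (k - l + (l - k)) * x ^ min k l)
        ≤ (2 * k * (b / (1 - b)) + b / (1 - b) ^ 2) * x ^ k := by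
      rw [Finset.sum_Ico_eq_sum_range]
      have hs := ((hd2.mul_left (2 * (k : ℝ))).add hd1).mul_right (x ^ k)
      refine le_trans (le_of_eq (Finset.sum_congr rfl fun d _ => ?_))
        (sum_le_hasSum (Finset.range (N - (k + 1))) (fun d _ => by positivity) hs)
      rw [show k - (k + 1 + d) + (k + 1 + d - k) = d + 1 by omega,
        min_eq_left (show k ≤ k + 1 + d by omega)]
      push_cast
      ring
    simp only [Nat.sub_self, add_zero, pow_zero, one_mul, min_self]
    linarith
  refine (Finset.sum_le_sum hrow).trans (sum_le_hasSum _ (fun k _ => ?_)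
    (((hasSum_coe_mul_pow hx0 hx1).mul_left _).add
      ((hasSum_geometric_of_lt_one hx0 hx1).mul_left _)))
  have : 0 < 1 - b := by linarith
  positivity

/-- Shifting the index by `M - 1` and enlarging the terms by lowering the denominators leaves the
logarithm series; this is the source of `log (1 / p)`. -/
theorem sum_Ico_pow_div_le {q : ℝ} (hq0 : 0 ≤ q) (hq1 : q < 1) {M : ℕ} (hM : M ≠ 0) (N : ℕ) :
    ∑ r ∈ Finset.Ico M N, q ^ r / r ≤ q ^ (M - 1) * -Real.log (1 - q) := by
  obtain ⟨M, rfl⟩ := Nat.exists_eq_succ_of_ne_zero hM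
  have hs := Real.hasSum_pow_div_log_of_abs_lt_one (by rwa [abs_of_nonneg hq0])
  rw [Finset.sum_Ico_eq_sum_range]
  refine le_trans (Finset.sum_le_sum fun s _ => ?_)
    (sum_le_hasSum (Finset.range (N - M.succ)) (fun s _ => by positivity)
      (hs.mul_left (q ^ (M.succ - 1))))
  rw [← mul_div_assoc, ← pow_add]
  have : M.succ + s = M.succ - 1 + (s + 1) := by omega
  rw [this]
  refine div_le_div_of_nonneg_left (by positivity) (by positivity) ?_
  push_cast
  linarith [(Nat.cast_nonneg (M.succ - 1) : (0 : ℝ) ≤ ((M.succ - 1 : ℕ) : ℝ))]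

theorem sum_range_triangle (T : ℕ → ℕ → ℕ → ℝ) (N : ℕ) :
    ∑ r ∈ Finset.range N, ∑ k ∈ Finset.range (r + 1), ∑ l ∈ Finset.range (r + 1), T r k l
      = ∑ k ∈ Finset.range N, ∑ l ∈ Finset.range N, ∑ r ∈ Finset.Ico (max k l) N, T r k l := by
  have h1 : ∀ r ∈ Finset.range N,
      ∑ k ∈ Finset.range (r + 1), ∑ l ∈ Finset.range (r + 1), T r k l
        = ∑ k ∈ Finset.range N, ∑ l ∈ Finset.range N, if max k l ≤ r then T r k l else 0 := by
    intro r hr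
    have hsub : Finset.range (r + 1) ⊆ Finset.range N := by
      intro k hk
      simp only [Finset.mem_range] at *
      omega
    rw [← Finset.sum_product', ← Finset.sum_product', ← Finset.sum_filter]
    refine Finset.sum_congr ?_ fun _ _ => rfl
    ext ⟨k, l⟩
    simp only [Finset.mem_product, Finset.mem_filter, Finset.mem_range] at *
    omega
  rw [Finset.sum_congr rfl h1, Finset.sum_comm]
  refine Finset.sum_congr rfl fun k _ => ?_
  rw [Finset.sum_comm]
  refine Finset.sum_congr rfl fun l _ => ?_
  rw [← Finset.sum_filter]
  refine Finset.sum_congr ?_ fun _ _ => rfl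
  ext r
  simp only [Finset.mem_filter, Finset.mem_range, Finset.mem_Ico]
  omega

/-- The upper bound for the variance of the cycling estimator given `R = r`. -/
noncomputable def varBound (c q b B : ℝ) (r : ℕ) : ℝ :=
  ∑ k ∈ Finset.range (r + 1), ∑ l ∈ Finset.range (r + 1),
    c / q ^ k * (c / q ^ l) * ((k + l) / r * (b ^ (k - l + (l - k)) * B ^ min k l))

theorem sum_geometric_mul_varBound_le {p c b B : ℝ} (hp0 : 0 < p) (hpB : p < 1 - B)
    (hb0 : 0 ≤ b) (hb1 : b < 1) (hB0 : 0 ≤ B) (N : ℕ) :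
    ∑ r ∈ Finset.range N, (1 - p) ^ r * p * varBound c (1 - p) b B r
      ≤ 4 * c ^ 2 * p * Real.log (1 / p) / (1 - p - B) ^ 2
          * (B + 2 * (b * (1 - p) / (1 - b) ^ 2)) := by
  set q := 1 - p with hq
  have hq0 : 0 < q := by linarith
  have hq1 : q < 1 := by linarith
  have hL : -Real.log (1 - q) = Real.log (1 / p) := by simp [hq]
  have hL0 : 0 ≤ Real.log (1 / p) := by
    refine Real.log_nonneg ?_
    rw [le_div_iff₀ hp0]
    linarith
  set L := Real.log (1 / p)
  have hx0 : 0 ≤ B / q := by positivity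
  have hx1 : B / q < 1 := (div_lt_one hq0).2 (by linarith)
  simp only [varBound, Finset.mul_sum]
  rw [sum_range_triangle]
  have hterm : ∀ k l : ℕ, ∑ r ∈ Finset.Ico (max k l) N,
      q ^ r * p * (c / q ^ k * (c / q ^ l) * ((k + l) / r * (b ^ (k - l + (l - k)) * B ^ min k l)))
        ≤ c ^ 2 * p * L / q * (((k : ℝ) + l) * (b ^ (k - l + (l - k)) * (B / q) ^ min k l)) := by
    intro k l
    -- The term `k = l = 0` vanishes through the factor `k + l`; elsewhere `max k l ≥ 1`, as the
    -- logarithmic bound requires.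
    rcases eq_or_ne (max k l) 0 with h0 | h0
    · obtain ⟨rfl, rfl⟩ : k = 0 ∧ l = 0 := by omega
      simp
    have hS := sum_Ico_pow_div_le hq0.le hq1 h0 N
    rw [hL] at hS
    have hpow : q ^ k * q ^ l = q ^ (max k l - 1) * (q * q ^ min k l) := by
      rw [← pow_add, ← pow_succ', ← pow_add]
      congr 1
      omega
    calc _ = p * c ^ 2 * ((k : ℝ) + l) * (b ^ (k - l + (l - k)) * B ^ min k l)
            / (q ^ k * q ^ l) * ∑ r ∈ Finset.Ico (max k l) N, q ^ r / r := by
          rw [Finset.mul_sum]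
          refine Finset.sum_congr rfl fun r _ => ?_
          rw [div_mul_div_comm, div_mul_eq_mul_div ((k : ℝ) + l), div_mul_div_comm,
            div_mul_div_comm, ← mul_div_assoc]
          congr 1
          ring
      _ ≤ p * c ^ 2 * ((k : ℝ) + l) * (b ^ (k - l + (l - k)) * B ^ min k l)
            / (q ^ k * q ^ l) * (q ^ (max k l - 1) * L) := by
          gcongr
      _ = _ := by
          rw [hpow, div_pow]
          field_simp
  refine (Finset.sum_le_sum fun k _ => Finset.sum_le_sum fun l _ => hterm k l).trans ?_
  simp only [← Finset.mul_sum]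
  refine (mul_le_mul_of_nonneg_left (sum_sum_add_mul_pow_le hb0 hb1 hx0 hx1 N)
    (by positivity)).trans ?_
  have hb' : 0 < 1 - b := by linarith
  have hqB : 0 < q - B := by linarith
  have hS : ((2 + 4 * (b / (1 - b))) * (B / q / (1 - B / q) ^ 2)
      + 2 * (b / (1 - b) ^ 2) * (1 - B / q)⁻¹) / q
      = ((2 + 4 * (b / (1 - b))) * B + 2 * (b / (1 - b) ^ 2) * (q - B)) / (q - B) ^ 2 := by
    have : 1 - B / q = (q - B) / q := by field_simp
    rw [this]
    field_simp
  -- With `u = b/(1-b)²` and `v = b/(1-b)`, the inequalities `v ≤ u` and `B ≤ q` give `4vB + 2uq ≤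
  -- 6uq`, within the `8uq` of the stated constant.
  have hT : (2 + 4 * (b / (1 - b))) * B + 2 * (b / (1 - b) ^ 2) * (q - B)
      ≤ 4 * (B + 2 * (b * q / (1 - b) ^ 2)) := by
    have h1 : b / (1 - b) ≤ b / (1 - b) ^ 2 := by
      refine div_le_div_of_nonneg_left hb0 (by positivity) ?_
      nlinarith
    have h2 : b * q / (1 - b) ^ 2 = b / (1 - b) ^ 2 * q := by ring
    have h3 : 0 ≤ b / (1 - b) := by positivity
    rw [h2]
    set u := b / (1 - b) ^ 2
    set v := b / (1 - b)
    have h4 : v * B ≤ u * q := mul_le_mul h1 (by linarith) hB0 (h3.trans h1)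
    have h5 : 0 ≤ u * B := mul_nonneg (h3.trans h1) hB0
    have h6 : 0 ≤ u * q := mul_nonneg (h3.trans h1) hq0.le
    nlinarith
  calc _ = c ^ 2 * p * L * (((2 + 4 * (b / (1 - b))) * (B / q / (1 - B / q) ^ 2)
        + 2 * (b / (1 - b) ^ 2) * (1 - B / q)⁻¹) / q) := by ring
    _ ≤ c ^ 2 * p * L * (4 * (B + 2 * (b * q / (1 - b) ^ 2)) / (q - B) ^ 2) := by
        rw [hS]
        gcongr
    _ = _ := by ring

theorem summable_geometric_mul_sq {p c b : ℝ} (hp0 : 0 < p) (hp1 : p < 1 - b ^ 2) (hb0 : 0 ≤ b)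
    {a : ℕ → ℝ} (ha : ∀ k, |a k| ≤ c * (b / (1 - p)) ^ k) :
    Summable fun r : ℕ => (1 - p) ^ r * p * (∑ k ∈ Finset.range (r + 1), a k) ^ 2 := by
  set q := 1 - p with hq
  have hq0 : 0 < q := by nlinarith [sq_nonneg b]
  have hq1 : q < 1 := by linarith
  -- The ratio `b / q` may lie on either side of 1. In both cases `q * ρ² < 1`, from `q < 1` or from
  -- `b² < q`, so the polynomial factor `(r + 1)²` is harmless.
  set ρ := max 1 (b / q)
  have hρ1 : 1 ≤ ρ := le_max_left _ _
  have hc : 0 ≤ c := by simpa using (abs_nonneg _).trans (ha 0)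
  have hqρ : q * ρ ^ 2 < 1 := by
    rcases max_choice 1 (b / q) with h | h
    · simp only [ρ, h]
      linarith
    · simp only [ρ, h]
      rw [div_pow, ← mul_div_assoc, div_lt_one (by positivity)]
      nlinarith
  have hsum : ∀ r : ℕ, (∑ k ∈ Finset.range (r + 1), a k) ^ 2
      ≤ c ^ 2 * (((r : ℝ) + 1) ^ 2 * (ρ ^ 2) ^ r) := by
    intro r
    have h1 : |∑ k ∈ Finset.range (r + 1), a k| ≤ ((r : ℝ) + 1) * (c * ρ ^ r) := by
      refine (Finset.abs_sum_le_sum_abs _ _).trans ?_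
      refine (Finset.sum_le_card_nsmul _ _ (c * ρ ^ r) fun k hk => (ha k).trans ?_).trans
        (by simp)
      have hk' : k ≤ r := Finset.mem_range_succ_iff.1 hk
      gcongr
      calc (b / q) ^ k ≤ ρ ^ k := by
            gcongr
            exact le_max_right _ _
        _ ≤ ρ ^ r := pow_le_pow_right₀ hρ1 hk'
    rw [← sq_abs]
    calc _ ≤ (((r : ℝ) + 1) * (c * ρ ^ r)) ^ 2 := by gcongr
      _ = _ := by ring
  have hn : ‖q * ρ ^ 2‖ < 1 := by
    rwa [Real.norm_of_nonneg (by positivity)]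
  have hS : Summable fun r : ℕ =>
      p * c ^ 2 * ((r : ℝ) ^ 2 * (q * ρ ^ 2) ^ r + 2 * ((r : ℝ) ^ 1 * (q * ρ ^ 2) ^ r)
        + (q * ρ ^ 2) ^ r) :=
    (((summable_pow_mul_geometric_of_norm_lt_one 2 hn).add
      ((summable_pow_mul_geometric_of_norm_lt_one 1 hn).mul_left 2)).add
        (summable_geometric_of_norm_lt_one hn)).mul_left _
  refine Summable.of_nonneg_of_le (fun r => by positivity) (fun r => ?_) hS
  calc _ ≤ q ^ r * p * (c ^ 2 * (((r : ℝ) + 1) ^ 2 * (ρ ^ 2) ^ r)) := by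
        gcongr
        exact hsum r
    _ = _ := by
        rw [mul_pow q]
        ring

/-- The bias of the estimator of fixed length `r`, for `p` bounded away from `1 - |α|`. -/
theorem abs_sum_sub_le {p c α s : ℝ} {γ : ℕ → ℝ} (hc : 0 ≤ c) (hγ : ∀ k, |γ k| ≤ c)
    (hα : |α| < 1) (hs : HasSum (fun k => γ k * α ^ k) s) (hp0 : 0 < p)
    (hp : p ≤ (1 - |α|) / 2) (r : ℕ) :
    |∑ k ∈ Finset.range (r + 1), γ k / (1 - p) ^ k * α ^ k - s|
      ≤ c * p * (2 * |α| / (1 + |α|) / (1 - 2 * |α| / (1 + |α|)) ^ 2)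
        + c * (|α| ^ r / (1 - |α|)) := by
  set q := 1 - p with hq
  set b := |α|
  have hb0 : 0 ≤ b := abs_nonneg α
  have hq0 : 0 < q := by linarith
  -- Since `p ≤ (1 - b) / 2` gives `q ≥ (1 + b) / 2`, this `y < 1` bounds `b / q` uniformly in `p`.
  -- Bernoulli's inequality `1 - q ^ k ≤ k * p` then makes the error from the weights `O(p)`; the
  -- truncation error is a geometric tail.
  set y := 2 * b / (1 + b) with hy
  have hy0 : 0 ≤ y := by positivity
  have hy1 : y < 1 := (div_lt_one (by positivity)).2 (by linarith)
  have hby : b / q ≤ y := by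
    rw [hy, div_le_div_iff₀ hq0 (by positivity)]
    nlinarith
  have hhead : |∑ k ∈ Finset.range (r + 1), (γ k / q ^ k * α ^ k - γ k * α ^ k)|
      ≤ c * p * (y / (1 - y) ^ 2) := by
    refine (Finset.abs_sum_le_sum_abs _ _).trans (le_trans (Finset.sum_le_sum fun k _ => ?_)
      (sum_le_hasSum (Finset.range (r + 1)) (fun k _ => by positivity)
        ((hasSum_coe_mul_pow hy0 hy1).mul_left (c * p))))
    have hqk : 0 < q ^ k := pow_pos hq0 k
    have hbern : 1 - q ^ k ≤ k * p := by
      have := one_add_mul_le_pow (a := -p) (by linarith) k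
      rw [← sub_eq_add_neg] at this
      linarith
    have hq1 : q ^ k ≤ 1 := pow_le_one₀ hq0.le (by linarith)
    have heq : γ k / q ^ k * α ^ k - γ k * α ^ k = γ k * ((1 - q ^ k) * (α ^ k / q ^ k)) := by
      field_simp
    rw [heq, abs_mul, abs_mul, abs_of_nonneg (sub_nonneg.2 hq1), abs_div, abs_pow,
      abs_of_pos hqk, ← div_pow]
    calc _ ≤ c * (k * p * y ^ k) := by
          gcongr
          exact hγ k
      _ = _ := by ring
  have htail : |∑ k ∈ Finset.range (r + 1), γ k * α ^ k - s| ≤ c * (b ^ r / (1 - b)) := by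
    rw [abs_sub_comm]
    have h1 := (hasSum_nat_add_iff' (r + 1)).2 hs
    have h2 : HasSum (fun k : ℕ => c * (b ^ r * b ^ k)) (c * (b ^ r / (1 - b))) := by
      rw [div_eq_mul_inv]
      exact ((hasSum_geometric_of_lt_one hb0 hα).mul_left _).mul_left _
    refine h1.norm_le_of_bounded h2 fun k => ?_
    rw [Real.norm_eq_abs, abs_mul, abs_pow, ← pow_add]
    refine mul_le_mul (hγ _) ?_ (by positivity) hc
    exact pow_le_pow_of_le_one hb0 hα.le (by omega)
  rw [Finset.sum_sub_distrib] at hhead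
  calc _ = |(∑ k ∈ Finset.range (r + 1), γ k / q ^ k * α ^ k
          - ∑ k ∈ Finset.range (r + 1), γ k * α ^ k)
          + (∑ k ∈ Finset.range (r + 1), γ k * α ^ k - s)| := by
        rw [sub_add_sub_cancel]
    _ ≤ _ := (abs_add_le _ _).trans (add_le_add hhead htail)

/-- After splitting the square, the first part is `O(p²)` against a probability and the second costs
`p * ∑ b ^ r`. The bounds `p² ≤ p` and `(b ^ r)² ≤ b ^ r` make both `O(p)`. -/
theorem sum_geometric_mul_sq_le {p c d b : ℝ} (hp0 : 0 < p) (hp1 : p < 1) (hb0 : 0 ≤ b)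
    (hb1 : b < 1) {g : ℕ → ℝ} (hg : ∀ r, |g r| ≤ c * p * d + c * (b ^ r / (1 - b))) (N : ℕ) :
    ∑ r ∈ Finset.range N, (1 - p) ^ r * p * g r ^ 2
      ≤ (2 * c ^ 2 * d ^ 2 + 2 * c ^ 2 / (1 - b) ^ 3) * p := by
  have hq0 : 0 < 1 - p := by linarith
  have hb' : 0 < 1 - b := by linarith
  have hgeo : HasSum (fun r : ℕ => (1 - p) ^ r * p) 1 := by
    have := (hasSum_geometric_of_lt_one hq0.le (by linarith)).mul_right p
    rwa [sub_sub_cancel, inv_mul_cancel₀ hp0.ne'] at this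
  have hS := (hgeo.mul_left (2 * c ^ 2 * d ^ 2 * p)).add
    ((hasSum_geometric_of_lt_one hb0 hb1).mul_left (2 * c ^ 2 / (1 - b) ^ 2 * p))
  refine le_trans (Finset.sum_le_sum fun r _ => ?_) (le_trans
    (sum_le_hasSum (Finset.range N) (fun r _ => by positivity) hS) (le_of_eq ?_))
  · have h1 : g r ^ 2 ≤ 2 * c ^ 2 * d ^ 2 * p + 2 * c ^ 2 / (1 - b) ^ 2 * b ^ r := by
      rw [← sq_abs]
      have hp2 : p ^ 2 ≤ p := by nlinarith
      have hbr : (b ^ r) ^ 2 ≤ b ^ r := by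
        have h0 : 0 ≤ b ^ r := by positivity
        have h1 : b ^ r ≤ 1 := pow_le_one₀ hb0 hb1.le
        nlinarith
      calc |g r| ^ 2 ≤ (c * p * d + c * (b ^ r / (1 - b))) ^ 2 := by
            gcongr
            exact hg r
        _ ≤ 2 * ((c * p * d) ^ 2 + (c * (b ^ r / (1 - b))) ^ 2) := add_sq_le
        _ = 2 * c ^ 2 * d ^ 2 * p ^ 2 + 2 * c ^ 2 / (1 - b) ^ 2 * (b ^ r) ^ 2 := by
            rw [mul_pow c (_ / _), div_pow]
            ring
        _ ≤ _ := by gcongr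
    have hq : (1 - p) ^ r ≤ 1 := pow_le_one₀ hq0.le (by linarith)
    calc _ ≤ (1 - p) ^ r * p
            * (2 * c ^ 2 * d ^ 2 * p + 2 * c ^ 2 / (1 - b) ^ 2 * b ^ r) := by gcongr
      _ = 2 * c ^ 2 * d ^ 2 * p * ((1 - p) ^ r * p)
            + (1 - p) ^ r * (2 * c ^ 2 / (1 - b) ^ 2 * p * b ^ r) := by ring
      _ ≤ 2 * c ^ 2 * d ^ 2 * p * ((1 - p) ^ r * p)
            + 1 * (2 * c ^ 2 / (1 - b) ^ 2 * p * b ^ r) := by gcongr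
      _ = _ := by ring
  · field_simp

end Series

/-! ### Tail, mean and integrals of the geometric law. -/

section Geometric

theorem geometricMeasure_real_Ici {p : unitInterval} (hp : p ≠ 0) (k : ℕ) :
    (geometricMeasure p).real {r | k ≤ r} = (1 - (p : ℝ)) ^ k := by
  have h1 : {r | k ≤ r} = ((Finset.range k : Finset ℕ) : Set ℕ)ᶜ := by ext; simp
  have h2 : (∑ i ∈ Finset.range k, (1 - (p : ℝ)) ^ i) * p = 1 - (1 - (p : ℝ)) ^ k := by
    have := geom_sum_mul_neg (1 - (p : ℝ)) k
    rwa [sub_sub_cancel] at this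
  rw [h1, probReal_compl_eq_one_sub (Finset.measurableSet _), ← sum_measureReal_singleton]
  simp only [geometricMeasure_real_singleton hp, ← Finset.sum_mul]
  rw [h2, sub_sub_cancel]

theorem integral_coe_geometricMeasure {p : unitInterval} (hp : p ≠ 0) :
    ∫ r, (r : ℝ) ∂geometricMeasure p = (1 - (p : ℝ)) / p := by
  have hp' : 0 < (p : ℝ) := unitInterval.pos_iff_ne_zero.2 hp
  rw [integral_geometricMeasure hp]
  have h := (hasSum_coe_mul_pow (b := 1 - (p : ℝ)) (by linarith [p.2.2]) (by linarith)).mul_right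
    (p : ℝ)
  convert! h.tsum_eq using 1
  · refine tsum_congr fun r => ?_
    rw [smul_eq_mul]
    ring
  · rw [sub_sub_cancel]
    field_simp

theorem integrable_geometricMeasure_and_integral_le {p : unitInterval} (hp : p ≠ 0)
    {v w : ℕ → ℝ} {C : ℝ} (hv0 : ∀ r, 0 ≤ v r) (hvw : ∀ r, v r ≤ w r)
    (hw : ∀ N, ∑ r ∈ Finset.range N, (1 - (p : ℝ)) ^ r * p * w r ≤ C) :
    Integrable v (geometricMeasure p) ∧ ∫ r, v r ∂geometricMeasure p ≤ C := by
  have h0 : ∀ r, 0 ≤ (1 - (p : ℝ)) ^ r * p * v r :=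
    fun r => mul_nonneg (geometricMeasure_nonneg p r) (hv0 r)
  have hle : ∀ N, ∑ r ∈ Finset.range N, (1 - (p : ℝ)) ^ r * p * v r ≤ C := fun N =>
    (Finset.sum_le_sum fun r _ =>
      mul_le_mul_of_nonneg_left (hvw r) (geometricMeasure_nonneg p r)).trans (hw N)
  constructor
  · rw [integrable_geometricMeasure_iff hp]
    simp only [Real.norm_of_nonneg (hv0 _)]
    exact summable_of_sum_range_le h0 hle
  · rw [integral_geometricMeasure hp]
    exact Real.tsum_le_of_sum_range_le h0 hle

end Geometric

/-! ### Assembling the bounds for the cycling estimator. -/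

section Cycling

variable {f : ℝ → ℝ} {x₀ m σ c : ℝ} {p : unitInterval} {Ω : Type*} [MeasurableSpace Ω]
  {μ : Measure Ω} {X : ℕ → Ω → ℝ} {R : Ω → ℕ}

theorem beta_sq : beta x₀ m σ ^ 2 = σ ^ 2 / x₀ ^ 2 + (m / x₀ - 1) ^ 2 :=
  Real.sq_sqrt (by positivity)

theorem betaZero_sq_le : betaZero x₀ m ^ 2 ≤ beta x₀ m σ ^ 2 := by
  rw [beta_sq, betaZero, sq_abs]
  have : 0 ≤ σ ^ 2 / x₀ ^ 2 := by positivity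
  linarith

theorem IsSample.indepMoments [IsProbabilityMeasure μ] (h : IsSample μ X R m σ p) :
    IndepMoments μ (fun i ω => X i ω / x₀ - 1) (m / x₀ - 1) (beta x₀ m σ ^ 2) := by
  have hL : ∀ i, MemLp (X i) 2 μ := fun i => (h.identDistrib_X i).memLp_iff.2 h.memLp_X
  have hm : ∀ i, ∫ ω, X i ω ∂μ = m := fun i =>
    (h.identDistrib_X i).integral_eq.trans h.mean_X
  have hv : ∀ i, ∫ ω, X i ω ^ 2 ∂μ = σ ^ 2 + m ^ 2 := by
    intro i
    have h1 := variance_eq_sub (hL i)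
    rw [(h.identDistrib_X i).variance_eq, h.variance_X, hm i] at h1
    simp only [Pi.pow_apply] at h1
    linarith
  have hi : ∀ i, Integrable (X i) μ := fun i => (hL i).integrable one_le_two
  refine ⟨fun i => ((h.measurable_X i).div_const _).sub_const _,
    h.iIndepFun_X.comp (fun _ x => x / x₀ - 1) fun _ => by fun_prop,
    fun i => ?_, fun i => ?_, fun i => ?_⟩
  · simp only [div_eq_mul_inv]
    exact ((hL i).mul_const _).sub (memLp_const 1)
  · rw [integral_sub ((hi i).div_const _) (integrable_const _), integral_div, hm i]
    simp
  · have heq : ∀ ω, (X i ω / x₀ - 1) ^ 2 = X i ω ^ 2 / x₀ ^ 2 - 2 / x₀ * X i ω + 1 := by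
      intro ω
      rw [sub_sq, div_pow]
      ring
    simp only [heq]
    rw [integral_add, integral_sub, integral_div, integral_const_mul, hv i, hm i, beta_sq]
    · simp only [integral_const, probReal_univ, smul_eq_mul]
      rw [sub_sq, div_pow]
      ring
    · exact (hL i).integrable_sq.div_const _
    · exact (hi i).const_mul _
    · exact ((hL i).integrable_sq.div_const _).sub ((hi i).const_mul _)
    · exact integrable_const _

theorem IsSample.cyclingEstimator_eq (h : IsSample μ X R m σ p) (hp : p ≠ 0) :
    cyclingEstimator μ f x₀ X R = fun ω =>
      fixedSum x₀ (fun k => taylorCoeff f x₀ k / (1 - (p : ℝ)) ^ k) (R ω) fun i => X i ω := by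
  have hk : ∀ k, μ.real {ω | k ≤ R ω} = (1 - (p : ℝ)) ^ k := by
    intro k
    rw [← geometricMeasure_real_Ici hp k, ← h.law_R,
      map_measureReal_apply h.measurable_R (Set.to_countable _).measurableSet]
    rfl
  funext ω
  simp only [cyclingEstimator, fixedSum, hk]
  exact Finset.sum_congr rfl fun k _ => by ring

theorem IsSample.integral_coe (h : IsSample μ X R m σ p) (hp : p ≠ 0) :
    ∫ ω, (R ω : ℝ) ∂μ = (1 - (p : ℝ)) / p := by
  rw [← integral_coe_geometricMeasure hp, ← h.law_R,
    integral_map h.measurable_R.aemeasurable (measurable_of_countable _).aestronglyMeasurable]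

theorem IsSample.memLp_and_expCondVar_le_and_variance_le [IsProbabilityMeasure μ]
    (h : IsSample μ X R m σ p) (hf : TaylorAssumption f x₀ m c) (hp0 : 0 < (p : ℝ))
    (hp1 : (p : ℝ) < 1 - beta x₀ m σ ^ 2) :
    MemLp (cyclingEstimator μ f x₀ X R) 2 μ ∧
      expCondVar μ (cyclingEstimator μ f x₀ X R) R ≤
        4 * c ^ 2 * (p : ℝ) * Real.log (1 / (p : ℝ)) / (1 - (p : ℝ) - beta x₀ m σ ^ 2) ^ 2 *
          (beta x₀ m σ ^ 2 +
            2 * (betaZero x₀ m * (1 - (p : ℝ)) / (1 - betaZero x₀ m) ^ 2)) ∧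
      ((p : ℝ) ≤ (1 - betaZero x₀ m) / 2 →
        Var[cyclingEstimator μ f x₀ X R; μ] ≤ expCondVar μ (cyclingEstimator μ f x₀ X R) R +
          (2 * c ^ 2 * (2 * betaZero x₀ m / (1 + betaZero x₀ m)
              / (1 - 2 * betaZero x₀ m / (1 + betaZero x₀ m)) ^ 2) ^ 2
            + 2 * c ^ 2 / (1 - betaZero x₀ m) ^ 3) * p) := by
  have hp : p ≠ 0 := unitInterval.pos_iff_ne_zero.1 hp0
  have hI := h.indepMoments (x₀ := x₀)
  have hc := hf.c_pos.le
  have hb0 : 0 ≤ betaZero x₀ m := abs_nonneg _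
  have hb1 := hf.betaZero_lt_one
  have hbB := betaZero_sq_le (x₀ := x₀) (m := m) (σ := σ)
  have hB0 : 0 ≤ beta x₀ m σ ^ 2 := sq_nonneg _
  rw [h.cyclingEstimator_eq hp]
  set a : ℕ → ℝ := fun k => taylorCoeff f x₀ k / (1 - (p : ℝ)) ^ k with ha
  set q := 1 - (p : ℝ) with hq
  have hq0 : 0 < q := by linarith
  have haw : ∀ k, |a k| ≤ c / q ^ k := by
    intro k
    rw [ha]
    simp only
    rw [abs_div, abs_of_pos (pow_pos hq0 k)]
    gcongr
    exact hf.coeff_le k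
  have hXm : Measurable fun ω i => X i ω := measurable_pi_lambda _ h.measurable_X
  have hV : ∀ r, Var[fun ω => fixedSum x₀ a r (fun i => X i ω); μ]
      ≤ varBound c q (betaZero x₀ m) (beta x₀ m σ ^ 2) r :=
    fun r => variance_fixedSum_le hI a r haw
  have hVar := integrable_geometricMeasure_and_integral_le hp
    (fun r => variance_nonneg (fun ω => fixedSum x₀ a r (fun i => X i ω)) μ) hV
    (sum_geometric_mul_varBound_le (c := c) hp0 hp1 hb0 hb1 hB0)
  have hmean : ∀ r, ∫ ω, fixedSum x₀ a r (fun i => X i ω) ∂μ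
      = ∑ k ∈ Finset.range (r + 1), a k * (m / x₀ - 1) ^ k := integral_fixedSum hI a
  have hMean : Integrable (fun r => (∫ ω, fixedSum x₀ a r (fun i => X i ω) ∂μ) ^ 2)
      (geometricMeasure p) := by
    rw [integrable_geometricMeasure_iff hp]
    simp only [hmean, Real.norm_of_nonneg (sq_nonneg _)]
    refine summable_geometric_mul_sq (b := betaZero x₀ m) (c := c) hp0 (by linarith) hb0
      fun k => ?_
    rw [abs_mul, abs_pow, div_pow, ← mul_div_assoc, mul_div_right_comm]
    exact mul_le_mul_of_nonneg_right (haw k) (by positivity)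
  rw [← h.law_R] at hVar hMean
  have hL := memLp_fixedSum hI a
  have hFm := measurable_fixedSum (x₀ := x₀) a
  refine ⟨memLp_comp_indep h.measurable_R hXm h.indepFun_R_X hFm hL hVar.1 hMean, ?_, ?_⟩
  · rw [expCondVar_comp_indep h.measurable_R hXm h.indepFun_R_X hFm hL hVar.1 hMean]
    exact hVar.2
  · intro hpb
    have hbias : ∀ r, |∫ ω, fixedSum x₀ a r (fun i => X i ω) ∂μ - f m|
        ≤ c * p * (2 * betaZero x₀ m / (1 + betaZero x₀ m)
            / (1 - 2 * betaZero x₀ m / (1 + betaZero x₀ m)) ^ 2)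
          + c * (betaZero x₀ m ^ r / (1 - betaZero x₀ m)) := by
      intro r
      rw [hmean]
      exact abs_sum_sub_le hc hf.coeff_le hb1 hf.hasSum hp0 hpb r
    have hB := integrable_geometricMeasure_and_integral_le hp
      (fun r => sq_nonneg (∫ ω, fixedSum x₀ a r (fun i => X i ω) ∂μ - f m)) (fun _ => le_rfl)
      (sum_geometric_mul_sq_le hp0 (by linarith) hb0 hb1 hbias)
    rw [← h.law_R] at hB
    exact (variance_comp_indep_le h.measurable_R hXm h.indepFun_R_X hFm hL hVar.1 hMean
      (f m) hB.1).trans (add_le_add le_rfl hB.2)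

/-- The constant in the bound `O(log E[R] / E[R])` for the expected conditional variance. -/
noncomputable def condVarConst (c b B : ℝ) : ℝ :=
  16 * c ^ 2 / (1 - B) ^ 2 * (B + 2 * (b / (1 - b) ^ 2))

theorem condVarConst_nonneg {c b B : ℝ} (hb0 : 0 ≤ b) (hB0 : 0 ≤ B) : 0 ≤ condVarConst c b B := by
  unfold condVarConst
  positivity

/-- Here `1 / p = 1 + M`. The threshold 3 exceeds `e`, so `log M ≥ 1`, and it ensures `1 + M ≤ M²`,
whence `log (1 / p) ≤ 2 * log M`. -/
theorem le_log_div_of_eq {p M : ℝ} (hp0 : 0 < p) (hM : M = (1 - p) / p) (hM3 : 3 ≤ M) :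
    p ≤ 1 / M ∧ p ≤ Real.log M / M ∧ 0 ≤ Real.log (1 / p) ∧
      p * Real.log (1 / p) ≤ 2 * (Real.log M / M) := by
  have hM0 : 0 < M := by linarith
  have hinv : 1 / p = 1 + M := by
    rw [hM]
    field_simp
    ring
  have hpM : p ≤ 1 / M := by
    rw [hM, one_div_div, le_div_iff₀ (by rw [hM, le_div_iff₀ hp0] at hM3; linarith)]
    nlinarith
  have hlogM : 1 ≤ Real.log M := by
    rw [Real.le_log_iff_exp_le hM0]
    exact Real.exp_one_lt_three.le.trans hM3
  have hlog : Real.log (1 / p) ≤ 2 * Real.log M := by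
    rw [hinv, ← Real.log_rpow hM0, Real.rpow_two]
    exact Real.log_le_log (by linarith) (by nlinarith)
  have hlog0 : 0 ≤ Real.log (1 / p) := by
    rw [hinv]
    exact Real.log_nonneg (by linarith)
  refine ⟨hpM, hpM.trans (by gcongr), hlog0, ?_⟩
  calc _ ≤ 1 / M * (2 * Real.log M) := by gcongr
    _ = _ := by ring

/-- Keeping `p` below `(1 - B) / 2` gives `1 - p - B ≥ (1 - B) / 2`; squaring this turns the
constant 4 into 16. -/
theorem explicit_bound_le {p c b B : ℝ} (hp0 : 0 < p) (hb0 : 0 ≤ b) (hB0 : 0 ≤ B)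
    (hB1 : B < 1) (hpB : p ≤ (1 - B) / 2) (hlog : 0 ≤ Real.log (1 / p)) :
    4 * c ^ 2 * p * Real.log (1 / p) / (1 - p - B) ^ 2 * (B + 2 * (b * (1 - p) / (1 - b) ^ 2))
      ≤ condVarConst c b B * (p * Real.log (1 / p)) := by
  have hB' : 0 < 1 - B := by linarith
  have hden : ((1 - B) / 2) ^ 2 ≤ (1 - p - B) ^ 2 :=
    pow_le_pow_left₀ (by linarith) (by linarith) 2
  have hnum : b * (1 - p) / (1 - b) ^ 2 ≤ b / (1 - b) ^ 2 := by
    refine div_le_div_of_nonneg_right ?_ (by positivity)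
    nlinarith
  have hp1 : 0 ≤ 1 - p := by linarith
  calc _ ≤ 4 * c ^ 2 * p * Real.log (1 / p) / ((1 - B) / 2) ^ 2
          * (B + 2 * (b / (1 - b) ^ 2)) := by gcongr
    _ = _ := by
        rw [condVarConst, div_pow, div_div_eq_mul_div]
        ring

end Cycling

end SumEstimator

theorem proposition3 (f : ℝ → ℝ) (x₀ m σ c : ℝ)
    (hf : SumEstimator.TaylorAssumption f x₀ m c)
    (hβ : SumEstimator.beta x₀ m σ < 1) :
    -- membership in `L²` and the explicit bound
    (∀ (p : unitInterval), 0 < (p : ℝ) → (p : ℝ) < 1 - SumEstimator.beta x₀ m σ ^ 2 →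
      ∀ {Ω : Type*} [MeasurableSpace Ω] (μ : Measure Ω) [IsProbabilityMeasure μ]
        (X : ℕ → Ω → ℝ) (R : Ω → ℕ), SumEstimator.IsSample μ X R m σ p →
        MemLp (SumEstimator.cyclingEstimator μ f x₀ X R) 2 μ ∧
        SumEstimator.expCondVar μ (SumEstimator.cyclingEstimator μ f x₀ X R) R ≤
          4 * c ^ 2 * (p : ℝ) * Real.log (1 / (p : ℝ)) /
              (1 - (p : ℝ) - SumEstimator.beta x₀ m σ ^ 2) ^ 2 *
            (SumEstimator.beta x₀ m σ ^ 2 +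
              2 * (SumEstimator.betaZero x₀ m * (1 - (p : ℝ)) /
                (1 - SumEstimator.betaZero x₀ m) ^ 2))) ∧
    -- `O(log E[R] / E[R])` as `E[R] → ∞`, for the expected conditional variance and for the
    -- variance, with constants that do not depend on `p` or on the variables `X`, `R`
    (∃ C K : ℝ, ∀ (p : unitInterval), 0 < (p : ℝ) →
      (p : ℝ) < 1 - SumEstimator.beta x₀ m σ ^ 2 →
      ∀ {Ω : Type*} [MeasurableSpace Ω] (μ : Measure Ω) [IsProbabilityMeasure μ]
        (X : ℕ → Ω → ℝ) (R : Ω → ℕ), SumEstimator.IsSample μ X R m σ p →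
        K ≤ ∫ ω, (R ω : ℝ) ∂μ →
        SumEstimator.expCondVar μ (SumEstimator.cyclingEstimator μ f x₀ X R) R ≤
          C * (Real.log (∫ ω, (R ω : ℝ) ∂μ) / ∫ ω, (R ω : ℝ) ∂μ) ∧
        Var[SumEstimator.cyclingEstimator μ f x₀ X R; μ] ≤
          C * (Real.log (∫ ω, (R ω : ℝ) ∂μ) / ∫ ω, (R ω : ℝ) ∂μ)) := by
  refine ⟨fun p hp0 hp1 Ω _ μ _ X R h =>
    have H := h.memLp_and_expCondVar_le_and_variance_le hf hp0 hp1
    ⟨H.1, H.2.1⟩, ?_⟩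
  have hb0 : 0 ≤ SumEstimator.betaZero x₀ m := abs_nonneg _
  have hb1 := hf.betaZero_lt_one
  have hB0 : 0 ≤ SumEstimator.beta x₀ m σ ^ 2 := sq_nonneg _
  have hB1 : SumEstimator.beta x₀ m σ ^ 2 < 1 :=
    pow_lt_one₀ (Real.sqrt_nonneg _) hβ two_ne_zero
  set b := SumEstimator.betaZero x₀ m
  set B := SumEstimator.beta x₀ m σ ^ 2
  have hb' : 0 < 1 - b := by linarith
  have hB' : 0 < 1 - B := by linarith
  have hC₁ := SumEstimator.condVarConst_nonneg (c := c) hb0 hB0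
  set C₁ := SumEstimator.condVarConst c b B
  obtain ⟨C₂, hC₂⟩ : ∃ C, C = 2 * c ^ 2 * (2 * b / (1 + b) / (1 - 2 * b / (1 + b)) ^ 2) ^ 2
    + 2 * c ^ 2 / (1 - b) ^ 3 := ⟨_, rfl⟩
  have hC₂0 : 0 ≤ C₂ := by
    rw [hC₂]
    positivity
  -- The 2 comes from `p * log (1 / p) ≤ 2 * (log M / M)`, and `C₂` is the constant of the squared
  -- bias. As `p ≤ 1 / M`, the last two thresholds force `p ≤ (1 - B) / 2` and `p ≤ (1 - b) / 2`.
  refine ⟨2 * C₁ + C₂, max 3 (max (2 / (1 - B)) (2 / (1 - b))), ?_⟩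
  intro p hp0 hp1 Ω _ μ _ X R h hK
  obtain ⟨-, hE, hV⟩ := h.memLp_and_expCondVar_le_and_variance_le hf hp0 hp1
  rw [← hC₂] at hV
  have hR := h.integral_coe (unitInterval.pos_iff_ne_zero.1 hp0)
  generalize ∫ ω, (R ω : ℝ) ∂μ = M at hK hR ⊢
  generalize SumEstimator.expCondVar μ (SumEstimator.cyclingEstimator μ f x₀ X R) R = V at hE hV ⊢
  have hM3 : 3 ≤ M := (le_max_left _ _).trans hK
  have hMB : 2 / (1 - B) ≤ M := ((le_max_left _ _).trans (le_max_right _ _)).trans hK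
  have hMb : 2 / (1 - b) ≤ M := ((le_max_right _ _).trans (le_max_right _ _)).trans hK
  have hM0 : 0 < M := by linarith
  obtain ⟨hpM, hpl, hlog, hplog⟩ := SumEstimator.le_log_div_of_eq hp0 hR hM3
  have hhalf : ∀ t : ℝ, 0 < t → 2 / t ≤ M → (p : ℝ) ≤ t / 2 := by
    intro t ht htM
    refine hpM.trans ?_
    rw [div_le_iff₀ ht] at htM
    rw [div_le_div_iff₀ hM0 two_pos]
    linarith
  have hE' : V ≤ 2 * C₁ * (Real.log M / M) := by
    refine (hE.trans (SumEstimator.explicit_bound_le hp0 hb0 hB0 hB1 (hhalf _ hB' hMB)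
      hlog)).trans ?_
    calc _ ≤ C₁ * (2 * (Real.log M / M)) := mul_le_mul_of_nonneg_left hplog hC₁
      _ = _ := by ring
  have hlM : 0 ≤ Real.log M / M := hp0.le.trans hpl
  have h2 : C₂ * p ≤ C₂ * (Real.log M / M) := mul_le_mul_of_nonneg_left hpl hC₂0
  have h3 : 0 ≤ C₂ * (Real.log M / M) := mul_nonneg hC₂0 hlM
  rw [add_mul]
  exact ⟨by linarith, (hV (hhalf _ hb' hMb)).trans (by linarith)⟩
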